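/- **Conventions.** A class of groups is always assumed closed under isomorphism. Let $\mathcal C$ be a class of groups closed under subgroups of finite index. A (real-valued) Euler characteristic on $\mathcal C$ is a map $\chi:\mathcal C\to\mathbb R$ such that $\chi(G_1)=\chi(G_2)$ whenever $G_1,G_2\in\mathcal C$ are isomorphic, and $\chi(K)=[G:K]\,\chi(G)$ whenever $G\in\mathcal C$ and $K$ is a subgroup of finite index in $G$. A group $G$ is *virtually in $\mathcal C$* if it has a finite-index subgroup $K$ with $K\in\mathcal C$; in that case one sets $\chi(G)=\chi(K)/[G:K]$. This does not depend on the choice of $K$ and extends $\chi$ from $\mathcal C$ to all groups that are virtually in $\mathcal C$. A group is *virtually torsion free* if it has a finite-index subgroup with no non-trivial element of finite order. **Theorem 3.5.** Let $\mathcal C$ be a class of groups closed under free products (of two groups) and under subgroups of finite index, and suppose that $\mathcal C$ contains the infinite cyclic group $\mathbb Z$. Let $\chi:\mathcal C\to\mathbb R$ be an Euler characteristic such that $\chi(A*B)=\chi(A)+\chi(B)-1$ for all $A,B\in\mathcal C$. (i) Let $G\in\mathcal C$ be residually finite or virtually torsion free, let $H$ be a finite subgroup of $G$, let $\varphi:H\to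 G$ be an injective homomorphism, and let $G*_H$ be the HNN extension of $G$ relative to $\varphi$. Then $G*_H$ is virtually in $\mathcal C$ and $$\chi(G*_H)=\chi(G)-\frac1{|H|}.$$ (ii) Let $G_1,G_2\in\mathcal C$, each of which is residually finite or virtually torsion free, let $H$ be a finite group with injective homomorphisms $H\to G_1$ and $H\to G_2$, and let $G_1*_HG_2$ be the corresponding amalgamated free product. Then $G_1*_HG_2$ is virtually in $\mathcal C$ and $$\chi(G_1*_HG_2)=\chi(G_1)+\chi(G_2)-\frac1{|H|}.$$ -/

import Mathlib

universe u

/-- A class of groups: a predicate on groups which is invariant under isomorphism. -/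
def IsGroupClass (C : (G : Type u) → [Group G] → Prop) : Prop :=
  ∀ (G₁ G₂ : Type u) [Group G₁] [Group G₂], Nonempty (G₁ ≃* G₂) → C G₁ → C G₂

/-- The class `C` is closed under subgroups of finite index. -/
def ClosedUnderFiniteIndex (C : (G : Type u) → [Group G] → Prop) : Prop :=
  ∀ (G : Type u) [Group G], C G → ∀ K : Subgroup G, K.FiniteIndex → C K

/-- The class `C` is closed under (binary) free products. -/
def ClosedUnderFreeProducts (C : (G : Type u) → [Group G] → Prop) : Prop :=
  ∀ (A B : Type u) [Group A] [Group B], C A → C B → C (Monoid.Coprod A B)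

/-- `χ` is a real-valued Euler characteristic on the class `C`.
A map `C → ℝ` is given by a function on all groups of which only the values on members of `C`
are ever constrained or used. -/
structure IsEulerCharacteristic (C : (G : Type u) → [Group G] → Prop)
    (χ : (G : Type u) → [Group G] → ℝ) : Prop where
  /-- `χ` is an isomorphism invariant on `C`. -/
  iso_inv : ∀ (G₁ G₂ : Type u) [Group G₁] [Group G₂], C G₁ → C G₂ →
    Nonempty (G₁ ≃* G₂) → χ G₁ = χ G₂
  /-- `χ(K) = [G : K] χ(G)` for every subgroup `K` of finite index. -/
  index_mul : ∀ (G : Type u) [Group G], C G → ∀ K : Subgroup G, K.FiniteIndex →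
    χ K = (K.index : ℝ) * χ G

/-- `G` is virtually in `C`: some subgroup of finite index belongs to `C`. -/
def VirtuallyIn (C : (G : Type u) → [Group G] → Prop) (G : Type u) [Group G] : Prop :=
  ∃ K : Subgroup G, K.FiniteIndex ∧ C K

/-- `G` is virtually torsion free: some subgroup of finite index has no nontrivial element of
finite order. -/
def VirtuallyTorsionFree (G : Type u) [Group G] : Prop :=
  ∃ K : Subgroup G, K.FiniteIndex ∧ ∀ g ∈ K, IsOfFinOrder g → g = 1

open Classical in
/-- Wall's extension of `χ` to groups which are virtually in `C`: `χ(K) / [G : K]` for a subgroup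
`K` of finite index in `C`. By `wallExtension_eq` below the choice of `K` does not matter. (The
value is `0` on groups which are not virtually in `C`.) -/
noncomputable def wallExtension (C : (G : Type u) → [Group G] → Prop)
    (χ : (G : Type u) → [Group G] → ℝ) (G : Type u) [Group G] : ℝ :=
  if h : ∃ K : Subgroup G, K.FiniteIndex ∧ C K then χ h.choose / (h.choose.index : ℝ) else 0

/-- Two subgroups of finite index in `C` give the same quotient `χ(K) / [G : K]`. -/
theorem IsEulerCharacteristic.div_index_eq {C : (G : Type u) → [Group G] → Prop}
    {χ : (G : Type u) → [Group G] → ℝ} (hC : ClosedUnderFiniteIndex C) (hiso : IsGroupClass C)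
    (hχ : IsEulerCharacteristic C χ) {G : Type u} [Group G] (K L : Subgroup G)
    (hK : K.FiniteIndex) (hL : L.FiniteIndex) (hCK : C K) (hCL : C L) :
    χ K / (K.index : ℝ) = χ L / (L.index : ℝ) := by
  have key : ∀ M N : Subgroup G, M.FiniteIndex → N.FiniteIndex → C M →
      C (M ⊓ N : Subgroup G) ∧
        χ M / (M.index : ℝ) = χ (M ⊓ N : Subgroup G) / ((M ⊓ N).index : ℝ) := by
    intro M N hM hN hCM
    have hfi : ((M ⊓ N).subgroupOf M).FiniteIndex := inferInstance
    have e : ((M ⊓ N).subgroupOf M) ≃* (M ⊓ N : Subgroup G) :=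
      Subgroup.subgroupOfEquivOfLe inf_le_left
    have h1 : C ((M ⊓ N).subgroupOf M) := hC M hCM _ hfi
    have h2 : C (M ⊓ N : Subgroup G) := hiso _ _ ⟨e⟩ h1
    refine ⟨h2, ?_⟩
    have h3 := hχ.index_mul M hCM _ hfi
    rw [hχ.iso_inv _ _ h1 h2 ⟨e⟩] at h3
    have h4 : ((M ⊓ N).subgroupOf M).index * M.index = (M ⊓ N).index :=
      Subgroup.relIndex_mul_index inf_le_left
    have h5 : (((M ⊓ N).subgroupOf M).index : ℝ) ≠ 0 := Nat.cast_ne_zero.2 hfi.index_ne_zero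
    have h6 : (M.index : ℝ) ≠ 0 := Nat.cast_ne_zero.2 hM.index_ne_zero
    rw [h3, ← h4]
    push_cast
    field_simp
  have h1 := (key K L hK hL hCK).2
  have h2 := (key L K hL hK hCL).2
  rw [inf_comm] at h2
  rw [h1, h2]

/-- Wall's extension is well defined. -/
theorem wallExtension_eq {C : (G : Type u) → [Group G] → Prop}
    {χ : (G : Type u) → [Group G] → ℝ} (hC : ClosedUnderFiniteIndex C) (hiso : IsGroupClass C)
    (hχ : IsEulerCharacteristic C χ) {G : Type u} [Group G] (K : Subgroup G)
    (hK : K.FiniteIndex) (hCK : C K) :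
    wallExtension C χ G = χ K / (K.index : ℝ) := by
  have h : ∃ K : Subgroup G, K.FiniteIndex ∧ C K := ⟨K, hK, hCK⟩
  rw [wallExtension, dif_pos h]
  exact hχ.div_index_eq hC hiso _ _ h.choose_spec.1 hK h.choose_spec.2 hCK

/-- Wall's extension agrees with `χ` on the members of `C`. -/
theorem wallExtension_of_mem {C : (G : Type u) → [Group G] → Prop}
    {χ : (G : Type u) → [Group G] → ℝ} (hC : ClosedUnderFiniteIndex C) (hiso : IsGroupClass C)
    (hχ : IsEulerCharacteristic C χ) {G : Type u} [Group G] (hG : C G) :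
    wallExtension C χ G = χ G := by
  have h : C (⊤ : Subgroup G) := hiso _ _ ⟨Subgroup.topEquiv.symm⟩ hG
  rw [wallExtension_eq hC hiso hχ (⊤ : Subgroup G) inferInstance h,
    hχ.iso_inv _ _ h hG ⟨Subgroup.topEquiv⟩]
  simp

/-! Both formulas come from one finite-index subgroup. Let Γ be the HNN extension or amalgam. Finite
quotients of the factors in which the finite associated subgroups embed yield a transitive action of
Γ on a finite set X on which H acts freely. A point stabilizer in Γ has index |X|, and it is a free
product: one factor per orbit of each vertex group on X, namely a point stabilizer in that group,
and a free group. The free rank is the number of H-orbits minus the edges of a spanning tree of the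
graph whose vertices are the vertex-group orbits and whose edges are the H-orbits. The additivity of
χ, χ(ℤ) = 0, the orbit-stabilizer count and |X|/|H| for the number of H-orbits then give |X| times
the claimed value.

The shape of the stabilizer is obtained without normal forms or trees. With P the candidate free
product, Γ acts on X × P, through cocycles X → P, by left translations between fibres. A
homomorphism Ψ : P → Γ in the opposite direction turns these cocycles into conjugated elements of Γ.
`SkewLift.nonempty_stabilizer_equiv` shows that this data identifies P with a stabilizer;
`HNNExtension.nonempty_stabilizer_equiv` and `PushoutI.nonempty_stabilizer_equiv` build it. -/

open Monoid

/-! ### Isomorphisms between free products -/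

/-- The transport homomorphism between two members of a family of groups with equal indices. -/
def castHom {ι : Type*} (A : ι → Type*) [∀ i, Group (A i)] {i j : ι} (h : i = j) : A i →* A j :=
  h ▸ MonoidHom.id (A i)

theorem CoprodI.of_castHom {ι : Type*} {A : ι → Type*} [∀ i, Group (A i)] {i j : ι} (h : i = j)
    (x : A i) : (CoprodI.of (castHom A h x) : CoprodI A) = CoprodI.of x := by
  subst h; rfl

/-- Reindexing a free product. -/
def CoprodI.reindex {ι κ : Type*} (e : ι ≃ κ) (A : κ → Type*) [∀ i, Group (A i)] :
    CoprodI (fun i => A (e i)) ≃* CoprodI A := by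
  refine MonoidHom.toMulEquiv
    (CoprodI.lift fun i => (CoprodI.of : A (e i) →* CoprodI A))
    (CoprodI.lift fun j => (CoprodI.of (M := fun i => A (e i)) (i := e.symm j)).comp
      (castHom A (e.apply_symm_apply j).symm)) ?_ ?_
  · ext i x
    have key : ∀ k (hk : i = k) (h : e i = e k),
        (CoprodI.of (M := fun i => A (e i)) (i := k) (castHom A h x)) =
          CoprodI.of (M := fun i => A (e i)) (i := i) x := by
      rintro k rfl h; rfl
    simpa using key _ (e.symm_apply_apply i).symm (by simp)
  · ext j x
    simpa using CoprodI.of_castHom (e.apply_symm_apply j).symm x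

/-- Splitting one factor off a free product. -/
def CoprodI.optionEquiv {ι : Type*} (A : Option ι → Type*) [∀ i, Group (A i)] :
    CoprodI A ≃* Coprod (A none) (CoprodI fun i => A (some i)) := by
  refine MonoidHom.toMulEquiv
    (CoprodI.lift fun i => match i with
      | none => Coprod.inl
      | some i => Coprod.inr.comp (CoprodI.of (M := fun i => A (some i)) (i := i)))
    (Coprod.lift (CoprodI.of (i := none)) (CoprodI.lift fun i => CoprodI.of (i := some i))) ?_ ?_
  · ext i x
    cases i <;> simp
  · ext i x <;> simp

/-- Free product with a trivial group. -/
def Coprod.equivOfSubsingleton (A B : Type*) [Group A] [Group B] [Subsingleton B] :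
    Coprod A B ≃* A :=
  MonoidHom.toMulEquiv (Coprod.lift (MonoidHom.id A) 1) Coprod.inl
    (by
      ext x
      · simp
      · simp [Subsingleton.elim x 1])
    (by ext x; simp)

/-! ### Euler characteristics of finite free products -/

/-- A class of groups with an Euler characteristic, closed under free products and finite index
subgroups, containing `ℤ`, and with the expected value on free products. -/
structure IsFreelyAdditive (C : (G : Type u) → [Group G] → Prop)
    (χ : (G : Type u) → [Group G] → ℝ) : Prop where
  iso : IsGroupClass C
  prod : ClosedUnderFreeProducts C
  index : ClosedUnderFiniteIndex C
  int : C (ULift.{u} (Multiplicative ℤ))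
  euler : IsEulerCharacteristic C χ
  euler_prod : ∀ (A B : Type u) [Group A] [Group B], C A → C B →
      χ (Coprod A B) = χ A + χ B - 1

/-- Membership in `C` together with the value of `χ`. -/
def HasEuler (C : (G : Type u) → [Group G] → Prop) (χ : (G : Type u) → [Group G] → ℝ)
    (G : Type u) [Group G] (r : ℝ) : Prop :=
  C G ∧ χ G = r

namespace IsFreelyAdditive

variable {C : (G : Type u) → [Group G] → Prop} {χ : (G : Type u) → [Group G] → ℝ}

theorem hasEuler_congr (h : IsFreelyAdditive C χ) {A B : Type u} [Group A] [Group B]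
    (e : A ≃* B) {r : ℝ} (hA : HasEuler C χ A r) : HasEuler C χ B r :=
  have hB := h.iso A B ⟨e⟩ hA.1
  ⟨hB, (h.euler.iso_inv A B hA.1 hB ⟨e⟩).symm.trans hA.2⟩

theorem hasEuler_coprod (h : IsFreelyAdditive C χ) {A B : Type u} [Group A] [Group B]
    {r s : ℝ} (hA : HasEuler C χ A r) (hB : HasEuler C χ B s) :
    HasEuler C χ (Coprod A B) (r + s - 1) :=
  ⟨h.prod A B hA.1 hB.1, by rw [h.euler_prod A B hA.1 hB.1, hA.2, hB.2]⟩

theorem hasEuler_subgroup (h : IsFreelyAdditive C χ) {A : Type u} [Group A] (hA : C A)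
    (K : Subgroup A) [hK : K.FiniteIndex] : HasEuler C χ K (K.index * χ A) :=
  ⟨h.index A hA K hK, h.euler.index_mul A hA K hK⟩

/-- The subgroup of squares has index 2 and is again infinite cyclic, so χ(ℤ) = 2χ(ℤ). -/
theorem hasEuler_int (h : IsFreelyAdditive C χ) :
    HasEuler C χ (ULift.{u} (Multiplicative ℤ)) 0 := by
  refine ⟨h.int, ?_⟩
  let f : ULift.{u} (Multiplicative ℤ) →* ULift.{u} (Multiplicative ℤ) := powMonoidHom 2
  have hf : Function.Injective f := by
    intro a b hab
    have h1 : a.down ^ 2 = b.down ^ 2 := congrArg ULift.down hab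
    have h2 := congrArg Multiplicative.toAdd h1
    simp only [toAdd_pow, nsmul_eq_mul, Nat.cast_ofNat, mul_eq_mul_left_iff,
      OfNat.ofNat_ne_zero, or_false] at h2
    exact ULift.ext _ _ (Multiplicative.toAdd.injective h2)
  have hindex : f.range.index = 2 := by
    have h1 : f.range = (AddSubgroup.toSubgroup (AddSubgroup.zmultiples (2 : ℤ))).comap
        (MulEquiv.ulift : ULift.{u} (Multiplicative ℤ) ≃* _).toMonoidHom := by
      ext x
      rw [MonoidHom.mem_range, Subgroup.mem_comap]
      change _ ↔ Multiplicative.toAdd x.down ∈ AddSubgroup.zmultiples (2 : ℤ)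
      rw [AddSubgroup.mem_zmultiples_iff]
      constructor
      · rintro ⟨y, rfl⟩
        refine ⟨Multiplicative.toAdd y.down, ?_⟩
        change _ = Multiplicative.toAdd (y.down ^ 2)
        simp [mul_comm]
      · rintro ⟨k, hk⟩
        refine ⟨ULift.up (Multiplicative.ofAdd k), ULift.ext _ _ ?_⟩
        change Multiplicative.ofAdd k ^ 2 = x.down
        apply Multiplicative.toAdd.injective
        rw [← hk]
        simp [mul_comm]
    rw [h1, Subgroup.index_comap_of_surjective _ MulEquiv.ulift.surjective]
    exact Int.index_zmultiples 2
  have hfin : f.range.FiniteIndex := ⟨by rw [hindex]; norm_num⟩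
  have h1 := hasEuler_subgroup h h.int f.range
  have h2 := hasEuler_congr h (MonoidHom.ofInjective hf).symm h1
  have h3 := h2.2
  rw [hindex] at h3
  push_cast at h3
  linarith

/-- The extra factor `B` starts the induction: the trivial group is not assumed to lie in `C`, so an
empty free product has no value of its own. -/
theorem hasEuler_coprod_coprodI (h : IsFreelyAdditive C χ) (ι : Type u) [Fintype ι] :
    ∀ (B : Type u) [Group B] (r : ℝ) (A : ι → Type u) [∀ i, Group (A i)] (s : ι → ℝ),
      HasEuler C χ B r → (∀ i, HasEuler C χ (A i) (s i)) →
        HasEuler C χ (Coprod B (CoprodI A)) (r + ∑ i, (s i - 1)) := by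
  refine Fintype.induction_empty_option (P := fun ι _ => ∀ (B : Type u) [Group B] (r : ℝ)
    (A : ι → Type u) [∀ i, Group (A i)] (s : ι → ℝ),
      HasEuler C χ B r → (∀ i, HasEuler C χ (A i) (s i)) →
        HasEuler C χ (Coprod B (CoprodI A)) (r + ∑ i, (s i - 1))) ?_ ?_ ?_ ι
  · intro α β _ e ih B _ r A _ s hB hA
    let _ := Fintype.ofEquiv β e.symm
    have := ih B r (fun i => A (e i)) (fun i => s (e i)) hB fun i => hA _
    rw [← e.sum_comp fun i => s i - 1]
    exact hasEuler_congr h (MulEquiv.coprodCongr (MulEquiv.refl B) (CoprodI.reindex e A)) this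
  · intro B _ r A _ s hB hA
    have : Subsingleton (CoprodI A) := by
      refine ⟨fun a b => ?_⟩
      have : ∀ a : CoprodI A, a = 1 := by
        intro a
        induction a using CoprodI.induction_left with
        | one => rfl
        | @mul i => exact i.elim
      rw [this a, this b]
    simpa using hasEuler_congr h (Coprod.equivOfSubsingleton B (CoprodI A)).symm hB
  · intro ι _ ih B _ r A _ s hB hA
    have := ih (Coprod B (A none)) _ (fun i => A (some i)) (fun i => s (some i))
      (hasEuler_coprod h hB (hA none)) fun i => hA _
    rw [Fintype.sum_option, show r + (s none - 1 + ∑ i, (s (some i) - 1)) =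
      r + s none - 1 + ∑ i, (s (some i) - 1) by ring]
    exact hasEuler_congr h ((MulEquiv.coprodAssoc _ _ _).trans
      (MulEquiv.coprodCongr (MulEquiv.refl B) (CoprodI.optionEquiv A).symm)) this

theorem hasEuler_coprodI (h : IsFreelyAdditive C χ) {ι : Type u} [Fintype ι] [Nonempty ι]
    (A : ι → Type u) [∀ i, Group (A i)] (s : ι → ℝ) (hA : ∀ i, HasEuler C χ (A i) (s i)) :
    HasEuler C χ (CoprodI A) (1 + ∑ i, (s i - 1)) := by
  classical
  let i₀ : ι := Classical.arbitrary ι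
  let e : Option {i // i ≠ i₀} ≃ ι := Equiv.optionSubtypeNe i₀
  have := h.hasEuler_coprod_coprodI {i // i ≠ i₀} (A (e none)) _ (fun i => A (e (some i)))
    (fun i => s (e (some i))) (hA _) fun i => hA _
  have h2 := hasEuler_congr h
    ((CoprodI.optionEquiv fun i => A (e i)).symm.trans (CoprodI.reindex e A)) this
  rw [← e.sum_comp fun i => s i - 1, Fintype.sum_option]
  convert h2 using 1
  ring

/-- Each free generator is a free factor ℤ and contributes χ(ℤ) − 1 = −1. -/
theorem hasEuler_coprod_freeGroup (h : IsFreelyAdditive C χ) {B : Type u} [Group B] {r : ℝ}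
    (hB : HasEuler C χ B r) (E : Type u) [Finite E] :
    HasEuler C χ (Coprod B (FreeGroup E)) (r - Nat.card E) := by
  have := Fintype.ofFinite E
  have e : FreeGroup E ≃* CoprodI fun _ : E => ULift.{u} (Multiplicative ℤ) := by
    refine MonoidHom.toMulEquiv
      (FreeGroup.lift fun i => CoprodI.of (M := fun _ : E => ULift.{u} (Multiplicative ℤ)) (i := i)
        (ULift.up (Multiplicative.ofAdd 1)))
      (CoprodI.lift fun i => (zpowersHom (FreeGroup E) (FreeGroup.of i)).comp
        MulEquiv.ulift.toMonoidHom) ?_ ?_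
    · ext i
      change FreeGroup.of i ^ (1 : ℤ) = FreeGroup.of i
      simp
    · refine CoprodI.ext_hom _ _ fun i => ?_
      ext ⟨x⟩
      have hx : (ULift.up x : ULift.{u} (Multiplicative ℤ)) =
          (ULift.up (Multiplicative.ofAdd 1)) ^ (Multiplicative.toAdd x) := by
        apply ULift.ext
        change x = (Multiplicative.ofAdd (1 : ℤ)) ^ (Multiplicative.toAdd x)
        rw [← ofAdd_zsmul]; simp
      rw [hx]
      simp only [map_zpow]
      congr 1
  have h1 := h.hasEuler_coprod_coprodI E B r (fun _ => ULift.{u} (Multiplicative ℤ)) 0 hB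
    fun _ => h.hasEuler_int
  have h2 := hasEuler_congr h (MulEquiv.coprodCongr (MulEquiv.refl B) e.symm) h1
  convert h2 using 1
  simp [sub_eq_add_neg]

theorem sum_index_stabilizer {G X : Type*} [Group G] [MulAction G X] [Finite X]
    [Fintype (MulAction.orbitRel.Quotient G X)] :
    ∑ v : MulAction.orbitRel.Quotient G X, (MulAction.stabilizer G v.out).index = Nat.card X := by
  rw [Nat.card_congr (MulAction.selfEquivSigmaOrbitsQuotientStabilizer G X)]
  have : ∀ x : X, Finite (G ⧸ MulAction.stabilizer G x) := fun x =>
    Finite.of_equiv _ (MulAction.orbitEquivQuotientStabilizer G x)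
  rw [Nat.card_sigma]
  rfl

/-- The free product of the point stabilizers, one for each orbit. -/
theorem hasEuler_coprodI_stabilizer (h : IsFreelyAdditive C χ) {G X : Type u} [Group G]
    [MulAction G X] [Finite X] [Nonempty X] (hG : C G) :
    HasEuler C χ
      (CoprodI fun v : MulAction.orbitRel.Quotient G X => MulAction.stabilizer G v.out)
      (1 + Nat.card X * χ G - Nat.card (MulAction.orbitRel.Quotient G X)) := by
  have := Fintype.ofFinite (MulAction.orbitRel.Quotient G X)
  have : Nonempty (MulAction.orbitRel.Quotient G X) := ⟨Quotient.mk'' (Classical.arbitrary X)⟩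
  have hfin : ∀ x : X, (MulAction.stabilizer G x).FiniteIndex := fun x =>
    ⟨by rw [MulAction.index_stabilizer]; exact (Set.ncard_pos (Set.toFinite _)).2
          (MulAction.nonempty_orbit x) |>.ne'⟩
  have h1 := h.hasEuler_coprodI
    (fun v : MulAction.orbitRel.Quotient G X => MulAction.stabilizer G v.out) _
    fun v => h.hasEuler_subgroup hG _
  convert h1 using 1
  -- Each orbit contributes (size of the orbit) · χ(G) − 1, and the sizes add up to |X|.
  rw [Finset.sum_sub_distrib, ← Finset.sum_mul, ← Nat.cast_sum, sum_index_stabilizer]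
  simp [add_sub_assoc]

end IsFreelyAdditive

/-! ### Orbit representatives and cocycles -/

open MulAction in
/-- For each point `x`, a group element moving the chosen representative of the orbit of `x`
to `x`; the element is `1` for the representatives themselves. -/
theorem MulAction.exists_section (G X : Type*) [Group G] [MulAction G X] :
    ∃ s : X → G, (∀ x, s x • (Quotient.mk'' x : orbitRel.Quotient G X).out = x) ∧
      ∀ v : orbitRel.Quotient G X, s v.out = 1 := by
  classical
  have h1 : ∀ x : X, ∃ g : G, g • (Quotient.mk'' x : orbitRel.Quotient G X).out = x := by
    intro x
    have : orbitRel G X x (Quotient.mk'' x : orbitRel.Quotient G X).out :=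
      Quotient.exact' (Quotient.out_eq' (Quotient.mk'' x : orbitRel.Quotient G X)).symm
    exact orbitRel_apply.1 this
  choose s hs using h1
  refine ⟨fun x => if (Quotient.mk'' x : orbitRel.Quotient G X).out = x then 1 else s x,
    fun x => ?_, fun v => ?_⟩
  · dsimp only
    split_ifs with h
    · rw [one_smul, h]
    · exact hs x
  · refine if_pos ?_
    exact congrArg Quotient.out (Quotient.out_eq' v)

section OrbitCocycle

open MulAction

variable {G X P : Type*} [Group G] [MulAction G X] [Group P]

/-- A choice of `MulAction.exists_section`. -/
noncomputable def orbitSection (G : Type*) {X : Type*} [Group G] [MulAction G X] (x : X) : G :=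
  (exists_section G X).choose x

theorem orbitSection_smul (x : X) :
    orbitSection G x • (Quotient.mk'' x : orbitRel.Quotient G X).out = x :=
  (exists_section G X).choose_spec.1 x

theorem orbitSection_out (v : orbitRel.Quotient G X) : orbitSection G v.out = 1 :=
  (exists_section G X).choose_spec.2 v

theorem mk_smul_eq (g : G) (x : X) :
    (Quotient.mk'' (g • x) : orbitRel.Quotient G X) = Quotient.mk'' x :=
  Quotient.sound' (orbitRel_apply.2 (mem_orbit x g))

/-- A `P`-valued cocycle for the action of `G` on `X`. -/
def IsCocycle (d : G → X → P) : Prop :=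
  ∀ g h x, d (g * h) x = d g (h • x) * d h x

theorem IsCocycle.one {d : G → X → P} (hd : IsCocycle d) (x : X) : d 1 x = 1 := by
  have := hd 1 1 x
  simpa using this

/-- The element takes the representative to x, then to g • x, then back. These loops are the
arguments at which `orbitCocycle` evaluates `f`. -/
theorem section_conj_mem (g : G) (x : X) :
    (orbitSection G (g • x))⁻¹ * g * orbitSection G x ∈
      stabilizer G (Quotient.mk'' x : orbitRel.Quotient G X).out := by
  rw [mem_stabilizer_iff, mul_smul, orbitSection_smul, mul_smul, inv_smul_eq_iff,
    ← mk_smul_eq g x, orbitSection_smul]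

variable (f : ∀ v : orbitRel.Quotient G X, stabilizer G v.out →* P)

/-- The cocycle assembled from homomorphisms defined on the point stabilizers. -/
noncomputable def orbitCocycle (g : G) (x : X) : P :=
  f (Quotient.mk'' x) ⟨_, section_conj_mem g x⟩

theorem stabilizer_hom_congr {v w : orbitRel.Quotient G X} (h : v = w) {a b : G} (hab : a = b)
    (ha : a ∈ stabilizer G v.out) (hb : b ∈ stabilizer G w.out) : f v ⟨a, ha⟩ = f w ⟨b, hb⟩ := by
  subst h hab; rfl

theorem isCocycle_orbitCocycle : IsCocycle (orbitCocycle f) := by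
  intro g h x
  have hmem : (orbitSection G (g • h • x))⁻¹ * g * orbitSection G (h • x) ∈
      stabilizer G (Quotient.mk'' x : orbitRel.Quotient G X).out := by
    have := section_conj_mem g (h • x)
    rwa [mk_smul_eq] at this
  have h1 : orbitCocycle f g (h • x) = f (Quotient.mk'' x) ⟨_, hmem⟩ :=
    stabilizer_hom_congr f (mk_smul_eq h x) rfl _ _
  rw [h1, orbitCocycle, orbitCocycle, ← map_mul]
  refine congrArg _ (Subtype.ext ?_)
  simp only [mul_smul, Subgroup.coe_mul]
  group

theorem orbitCocycle_stabilizer (v : orbitRel.Quotient G X) (a : stabilizer G v.out) :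
    orbitCocycle f a v.out = f v a := by
  refine stabilizer_hom_congr f (Quotient.out_eq' v) ?_ _ a.2
  rw [mem_stabilizer_iff.1 a.2, orbitSection_out]
  simp

theorem orbitCocycle_section (x : X) :
    orbitCocycle f (orbitSection G x) (Quotient.mk'' x : orbitRel.Quotient G X).out = 1 := by
  rw [← map_one (f (Quotient.mk'' x))]
  refine stabilizer_hom_congr f (Quotient.out_eq' _) ?_ _ (one_mem _)
  rw [orbitSection_smul, orbitSection_out]
  simp

/-- If Ψ undoes each `f v` up to conjugation by σ, then it trivializes the whole cocycle, with the
section times σ as the coboundary. This supplies the second condition of `SkewLift`. -/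
theorem map_orbitCocycle {Γ : Type*} [Group Γ] (Ψ : P →* Γ) (j : G →* Γ)
    (σ : orbitRel.Quotient G X → Γ)
    (hΨ : ∀ v (a : stabilizer G v.out), Ψ (f v a) = (σ v)⁻¹ * j a * σ v) (g : G) (x : X) :
    Ψ (orbitCocycle f g x) = (j (orbitSection G (g • x)) * σ (Quotient.mk'' (g • x)))⁻¹ * j g *
      (j (orbitSection G x) * σ (Quotient.mk'' x)) := by
  rw [orbitCocycle, hΨ, mk_smul_eq]
  simp only [map_mul, map_inv]
  group

/-- The action on `X × P` attached to a cocycle. -/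
def skewHom {d : G → X → P} (hd : IsCocycle d) : G →* Equiv.Perm (X × P) :=
  MonoidHom.toHomPerm
    { toFun := fun g z => (g • z.1, d g z.1 * z.2)
      map_one' := by
        funext z
        exact Prod.ext (one_smul G z.1) (by
          change d 1 z.1 * z.2 = z.2
          rw [hd.one, one_mul])
      map_mul' := fun g h => by
        funext z
        exact Prod.ext (mul_smul g h z.1) (by
          change d (g * h) z.1 * z.2 = d g (h • z.1) * (d h z.1 * z.2)
          rw [hd g h, mul_assoc]) }

@[simp]
theorem skewHom_apply {d : G → X → P} (hd : IsCocycle d) (g : G) (x : X) (p : P) :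
    skewHom hd g (x, p) = (g • x, d g x * p) := rfl

/-- The fibrewise left translation of `X × P` over a permutation of `X`. -/
def skewPerm (t : Equiv.Perm X) (e : X → P) : Equiv.Perm (X × P) where
  toFun z := (t z.1, e z.1 * z.2)
  invFun z := (t.symm z.1, (e (t.symm z.1))⁻¹ * z.2)
  left_inv z := by simp
  right_inv z := by simp

@[simp]
theorem skewPerm_apply (t : Equiv.Perm X) (e : X → P) (x : X) (p : P) :
    skewPerm t e (x, p) = (t x, e x * p) := rfl

end OrbitCocycle

/-! ### Free actions -/

section Free

open MulAction

variable {H X P : Type*} [Group H] [MulAction H X] [Group P]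

/-- Only the identity fixes a point. -/
def IsFreeAction (H X : Type*) [Group H] [MulAction H X] : Prop :=
  ∀ (h : H) (x : X), h • x = x → h = 1

theorem IsFreeAction.eq_of_smul_eq (hf : IsFreeAction H X) {a b : H} {x : X}
    (h : a • x = b • x) : a = b := by
  have : (b⁻¹ * a) • x = x := by rw [mul_smul, h, inv_smul_smul]
  exact (inv_mul_eq_one.1 (hf _ _ this)).symm

/-- In a free action only one element moves the representative to a given point, so the section is
equivariant. -/
theorem IsFreeAction.orbitSection_smul_eq (hf : IsFreeAction H X) (h : H) (x : X) :
    orbitSection H (h • x) = h * orbitSection H x := by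
  apply hf.eq_of_smul_eq (x := (Quotient.mk'' x : orbitRel.Quotient H X).out)
  rw [mul_smul, orbitSection_smul, ← mk_smul_eq h x, orbitSection_smul]

theorem IsFreeAction.card_eq (hf : IsFreeAction H X) :
    Nat.card X = Nat.card (orbitRel.Quotient H X) * Nat.card H := by
  rw [← Nat.card_prod]
  refine Nat.card_congr (selfEquivOrbitsQuotientProd fun x => ?_)
  exact (Subgroup.eq_bot_iff_forall _).2 fun h hh => hf h x hh

/-- Two cocycles of a free action are cohomologous, and the transfer function may be prescribed
on a set of representatives. -/
theorem IsFreeAction.exists_transfer (hf : IsFreeAction H X) {d₁ d₂ : H → X → P}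
    (h₁ : IsCocycle d₁) (h₂ : IsCocycle d₂) (ε : orbitRel.Quotient H X → P) :
    ∃ e : X → P, (∀ h x, e (h • x) * d₁ h x = d₂ h x * e x) ∧ (∀ ω, e ω.out = ε ω) ∧
      ∀ x, ∃ (h : H) (ω : orbitRel.Quotient H X), x = h • ω.out := by
  -- The intertwining relation, applied to the element moving the representative to x, forces this
  -- formula.
  refine ⟨fun x => d₂ (orbitSection H x) (Quotient.mk'' x : orbitRel.Quotient H X).out *
    ε (Quotient.mk'' x) *
      (d₁ (orbitSection H x) (Quotient.mk'' x : orbitRel.Quotient H X).out)⁻¹,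
    fun h x => ?_, fun ω => ?_, fun x => ⟨_, _, (orbitSection_smul x).symm⟩⟩
  · simp only [mk_smul_eq, hf.orbitSection_smul_eq]
    rw [h₁ h, h₂ h, orbitSection_smul]
    group
  · simp only [orbitSection_out, h₁.one, h₂.one]
    rw [show (Quotient.mk'' ω.out : orbitRel.Quotient H X) = ω from Quotient.out_eq' ω]
    simp

end Free

open MulAction in
/-- Free actions of `H` on finite sets of the same cardinality are isomorphic. -/
theorem exists_equivariant_equiv {H A B : Type*} [Group H] [Finite H] [Finite A] [Finite B]
    (iA : MulAction H A) (iB : MulAction H B) (hA : IsFreeAction H A) (hB : IsFreeAction H B)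
    (hcard : Nat.card A = Nat.card B) : ∃ θ : A ≃ B, ∀ (h : H) (a : A), θ (h • a) = h • θ a := by
  -- All orbits have |H| elements, so there are equally many on both sides; θ matches orbits and
  -- sends representatives to representatives.
  have h1 : Nat.card (orbitRel.Quotient H A) = Nat.card (orbitRel.Quotient H B) := by
    have := hA.card_eq.symm.trans (hcard.trans hB.card_eq)
    exact Nat.eq_of_mul_eq_mul_right Nat.card_pos this
  obtain ⟨e⟩ : Nonempty (orbitRel.Quotient H A ≃ orbitRel.Quotient H B) :=
    (Finite.card_eq).1 h1
  let θ : A → B := fun a => orbitSection H a • (e (Quotient.mk'' a)).out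
  have hθ : ∀ (h : H) (a : A), θ (h • a) = h • θ a := fun h a => by
    simp only [θ, mk_smul_eq, hA.orbitSection_smul_eq, mul_smul]
  have hinj : Function.Injective θ := by
    intro a b hab
    have hq : (Quotient.mk'' a : orbitRel.Quotient H A) = Quotient.mk'' b := by
      apply e.injective
      have := congrArg (Quotient.mk'' : B → orbitRel.Quotient H B) hab
      simp only [θ, mk_smul_eq] at this
      rwa [show ∀ w : orbitRel.Quotient H B, (Quotient.mk'' w.out : orbitRel.Quotient H B) = w
        from Quotient.out_eq', show ∀ w : orbitRel.Quotient H B,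
          (Quotient.mk'' w.out : orbitRel.Quotient H B) = w from Quotient.out_eq'] at this
    simp only [θ, hq] at hab
    rw [← orbitSection_smul (G := H) a, hB.eq_of_smul_eq hab, hq, orbitSection_smul]
  have hbij : Function.Bijective θ :=
    (Nat.bijective_iff_injective_and_card θ).2 ⟨hinj, hcard⟩
  exact ⟨Equiv.ofBijective θ hbij, hθ⟩

/-! ### Recognizing a point stabilizer -/

section SkewLift

open MulAction

variable {Γ X P : Type*} [Group Γ] [MulAction Γ X] [Group P]

/-- `F g` is the left translation by a function `c : X → P` over the action of `g`, and `Ψ` takes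
`c` to the conjugate of `g` by `τ`. -/
def SkewLift (F : Γ →* Equiv.Perm (X × P)) (Ψ : P →* Γ) (τ : X → Γ) (g : Γ) : Prop :=
  ∃ c : X → P, (∀ x p, F g (x, p) = (g • x, c x * p)) ∧
    ∀ x, Ψ (c x) = (τ (g • x))⁻¹ * g * τ x

variable {F : Γ →* Equiv.Perm (X × P)} {Ψ : P →* Γ} {τ : X → Γ}

/-- Together with closure under inverses, this leaves the lifting condition to be checked on
generators of Γ only. -/
theorem SkewLift.mul {g h : Γ} (hg : SkewLift F Ψ τ g) (hh : SkewLift F Ψ τ h) :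
    SkewLift F Ψ τ (g * h) := by
  obtain ⟨c, hc, hc'⟩ := hg
  obtain ⟨b, hb, hb'⟩ := hh
  refine ⟨fun x => c (h • x) * b x, fun x p => ?_, fun x => ?_⟩
  · rw [map_mul, Equiv.Perm.mul_apply, hb, hc, mul_smul, mul_assoc]
  · rw [map_mul, hc', hb', mul_smul]
    group

theorem SkewLift.inv {g : Γ} (hg : SkewLift F Ψ τ g) : SkewLift F Ψ τ g⁻¹ := by
  obtain ⟨c, hc, hc'⟩ := hg
  refine ⟨fun x => (c (g⁻¹ • x))⁻¹, fun x p => ?_, fun x => ?_⟩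
  · rw [map_inv, Equiv.Perm.inv_eq_iff_eq, hc]
    simp
  · rw [map_inv, hc', smul_inv_smul]
    group

/-- If every element of `Γ` lifts to `X × P` and the image of `Ψ` acts on the fibre over `x₀` by
left translation, then the stabilizer of `x₀` is isomorphic to `P`. -/
theorem SkewLift.nonempty_stabilizer_equiv (h : ∀ g, SkewLift F Ψ τ g) {x₀ : X}
    (hΨ : ∀ p q, F (Ψ p) (x₀, q) = (x₀, p * q)) : Nonempty (P ≃* stabilizer Γ x₀) := by
  have hmem : ∀ p, Ψ p ∈ stabilizer Γ x₀ := by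
    intro p
    obtain ⟨c, hc, -⟩ := h (Ψ p)
    have := hΨ p 1
    rw [hc] at this
    exact congrArg Prod.fst this
  refine ⟨MulEquiv.ofBijective (Ψ.codRestrict _ hmem) ⟨?_, ?_⟩⟩
  · intro p q hpq
    have h1 : Ψ p = Ψ q := congrArg Subtype.val hpq
    have h2 := hΨ p 1
    rw [h1, hΨ] at h2
    simpa using (congrArg Prod.snd h2).symm
  · rintro ⟨g, hg⟩
    obtain ⟨c, hc, -⟩ := h g
    have hgx : g • x₀ = x₀ := hg
    -- Surjectivity: the discrepancy between g and Ψ (c x₀) fixes (x₀, 1), so its translation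
    -- function is 1 at x₀. Applying Ψ makes a conjugate of the discrepancy trivial.
    have h3 : F (g⁻¹ * Ψ (c x₀)) (x₀, 1) = (x₀, 1) := by
      rw [map_mul, Equiv.Perm.mul_apply, hΨ, map_inv, Equiv.Perm.inv_eq_iff_eq, hc, hgx]
    obtain ⟨b, hb, hb'⟩ := h (g⁻¹ * Ψ (c x₀))
    have h4 : (g⁻¹ * Ψ (c x₀)) • x₀ = x₀ :=
      (stabilizer Γ x₀).mul_mem ((stabilizer Γ x₀).inv_mem hg) (hmem _)
    have h5 : b x₀ = 1 := by
      rw [hb] at h3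
      simpa using congrArg Prod.snd h3
    have h6 := hb' x₀
    rw [h5, h4, map_one] at h6
    have h7 : g⁻¹ * Ψ (c x₀) = 1 := by
      have : g⁻¹ * Ψ (c x₀) = τ x₀ * ((τ x₀)⁻¹ * (g⁻¹ * Ψ (c x₀)) * τ x₀) * (τ x₀)⁻¹ := by group
      rw [this, ← h6]
      group
    exact ⟨c x₀, Subtype.ext (inv_mul_eq_one.1 h7).symm⟩

/-- The elements of `P` whose image under `Ψ` acts on the fibre over `x₀` by left translation. -/
def translationSubgroup (F : Γ →* Equiv.Perm (X × P)) (Ψ : P →* Γ) (x₀ : X) : Subgroup P where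
  carrier := {p | ∀ q, F (Ψ p) (x₀, q) = (x₀, p * q)}
  one_mem' q := by simp
  mul_mem' {a b} ha hb q := by
    rw [map_mul, map_mul, Equiv.Perm.mul_apply, hb q, ha, mul_assoc]
  inv_mem' {a} ha q := by
    rw [map_inv, map_inv, Equiv.Perm.inv_eq_iff_eq, ha]
    simp

end SkewLift

/-! ### Spanning trees with potentials -/

/-- A connected finite graph whose edges carry labels in a group has a spanning tree `T` and a
potential `σ` for the labels on `T`. -/
theorem exists_spanning_tree {V E Γ : Type*} [Finite V] [Group Γ] (src tgt : E → V) (l : E → Γ)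
    (v₀ : V)
    (hconn : ∀ S : Set V, v₀ ∈ S → (∀ e, src e ∈ S ↔ tgt e ∈ S) → S = Set.univ) :
    ∃ (T : Finset E) (σ : V → Γ), T.card + 1 = Nat.card V ∧ σ v₀ = 1 ∧
      (∀ e ∈ T, σ (tgt e) = l e * σ (src e)) ∧
      ∀ S : Set V, v₀ ∈ S → (∀ e ∈ T, src e ∈ S ↔ tgt e ∈ S) → S = Set.univ := by
  classical
  have := Fintype.ofFinite V
  -- A subtree with n edges and vertex set `S` grows by an edge leaving `S`. Connectedness is
  -- expressed throughout by edge-saturated sets containing v₀.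
  have key : ∀ n : ℕ, n < Fintype.card V → ∃ (S : Finset V) (T : Finset E) (σ : V → Γ),
      S.card = n + 1 ∧ v₀ ∈ S ∧ T.card = n ∧ σ v₀ = 1 ∧
      (∀ e ∈ T, σ (tgt e) = l e * σ (src e)) ∧ (∀ e ∈ T, src e ∈ S ∧ tgt e ∈ S) ∧
      ∀ S' : Set V, v₀ ∈ S' → (∀ e ∈ T, src e ∈ S' ↔ tgt e ∈ S') → (S : Set V) ⊆ S' := by
    intro n
    induction n with
    | zero =>
      intro _
      exact ⟨{v₀}, ∅, 1, by simp, by simp, by simp, by simp, by simp, by simp,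
        fun S' h _ => by simpa using h⟩
    | succ n ih =>
      intro hn
      obtain ⟨S, T, σ, hS, hv, hT, hσ, hσT, hTS, hmin⟩ := ih (by omega)
      have hne : (S : Set V) ≠ Set.univ := by
        intro h
        have : S = Finset.univ := by simpa using h
        rw [this, Finset.card_univ] at hS
        omega
      obtain ⟨e, he⟩ : ∃ e, ¬ (src e ∈ S ↔ tgt e ∈ S) := by
        by_contra! hcon
        exact hne (hconn S hv (by simpa using hcon))
      have heT : e ∉ T := fun h => he ⟨fun _ => (hTS e h).2, fun _ => (hTS e h).1⟩
      -- Here `w` is the new endpoint of `e` and `γ` the potential that the label forces there; this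
      -- treats both orientations of `e` at once.
      have step : ∀ w γ, w ∉ S → (∀ S' : Set V, (S : Set V) ⊆ S' → (src e ∈ S' ↔ tgt e ∈ S') →
          w ∈ S') → Function.update σ w γ (tgt e) = l e * Function.update σ w γ (src e) →
          src e ∈ insert w S → tgt e ∈ insert w S →
          ∃ (S : Finset V) (T : Finset E) (σ : V → Γ),
            S.card = n + 1 + 1 ∧ v₀ ∈ S ∧ T.card = n + 1 ∧ σ v₀ = 1 ∧
            (∀ e ∈ T, σ (tgt e) = l e * σ (src e)) ∧ (∀ e ∈ T, src e ∈ S ∧ tgt e ∈ S) ∧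
            ∀ S' : Set V, v₀ ∈ S' → (∀ e ∈ T, src e ∈ S' ↔ tgt e ∈ S') → (S : Set V) ⊆ S' := by
        intro w γ hw hwS' hup hsrc htgt
        have hne' : ∀ v ∈ S, v ≠ w := fun v hv h => hw (h ▸ hv)
        refine ⟨insert w S, insert e T, Function.update σ w γ, ?_, Finset.mem_insert_of_mem hv,
          ?_, ?_, ?_, ?_, ?_⟩
        · rw [Finset.card_insert_of_notMem hw, hS]
        · rw [Finset.card_insert_of_notMem heT, hT]
        · rw [Function.update_of_ne (hne' _ hv), hσ]
        · intro e' he'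
          rcases Finset.mem_insert.1 he' with rfl | h
          · exact hup
          · rw [Function.update_of_ne (hne' _ (hTS e' h).1),
              Function.update_of_ne (hne' _ (hTS e' h).2), hσT e' h]
        · intro e' he'
          rcases Finset.mem_insert.1 he' with rfl | h
          · exact ⟨hsrc, htgt⟩
          · exact ⟨Finset.mem_insert_of_mem (hTS e' h).1, Finset.mem_insert_of_mem (hTS e' h).2⟩
        · intro S' h0 h1
          have h2 := hmin S' h0 fun e' he' => h1 e' (Finset.mem_insert_of_mem he')
          have h3 := hwS' S' h2 (h1 e (Finset.mem_insert_self _ _))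
          rw [Finset.coe_insert]
          exact Set.insert_subset h3 h2
      by_cases hs : src e ∈ S
      · have ht : tgt e ∉ S := fun h => he ⟨fun _ => h, fun _ => hs⟩
        have hst : src e ≠ tgt e := fun h => ht (h ▸ hs)
        exact step (tgt e) (l e * σ (src e)) ht (fun S' h1 h2 => h2.1 (h1 hs))
          (by rw [Function.update_self, Function.update_of_ne hst])
          (Finset.mem_insert_of_mem hs) (Finset.mem_insert_self _ _)
      · have ht : tgt e ∈ S := by
          by_contra h
          exact he ⟨fun h' => absurd h' hs, fun h' => absurd h' h⟩
        have hst : tgt e ≠ src e := fun h => hs (h ▸ ht)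
        exact step (src e) ((l e)⁻¹ * σ (tgt e)) hs (fun S' h1 h2 => h2.2 (h1 ht))
          (by rw [Function.update_self, Function.update_of_ne hst]; group)
          (Finset.mem_insert_self _ _) (Finset.mem_insert_of_mem ht)
  have hpos : 0 < Fintype.card V := Fintype.card_pos_iff.2 ⟨v₀⟩
  obtain ⟨S, T, σ, hS, hv, hT, hσ, hσT, hTS, hmin⟩ := key (Fintype.card V - 1) (by omega)
  have hSu : S = Finset.univ := by
    rw [← Finset.card_eq_iff_eq_univ]
    omega
  refine ⟨T, σ, ?_, hσ, hσT, fun S' h0 h1 => ?_⟩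
  · rw [Nat.card_eq_fintype_card]; omega
  · have := hmin S' h0 h1
    rw [hSu, Finset.coe_univ] at this
    exact Set.univ_subset_iff.1 this

/-! ### Point stabilizers in HNN extensions and amalgams -/

open MulAction in
/-- The free product of the stabilizers of the chosen orbit representatives. -/
abbrev StabilizerCoprod (G X : Type*) [Group G] [MulAction G X] : Type _ :=
  CoprodI fun v : orbitRel.Quotient G X => stabilizer G v.out

open MulAction in
/-- The inclusion of a point stabilizer in the free product of the stabilizers. -/
noncomputable def StabilizerCoprod.of {G X : Type*} [Group G] [MulAction G X]
    (v : orbitRel.Quotient G X) :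
    stabilizer G v.out →* StabilizerCoprod G X :=
  CoprodI.of (M := fun v : orbitRel.Quotient G X => stabilizer G v.out)

open MulAction in
/-- The homomorphism from the free product of the stabilizers which is conjugation by `(σ v)⁻¹` on
the factor of index `v`. -/
noncomputable def StabilizerCoprod.lift {G X Γ : Type*} [Group G] [MulAction G X] [Group Γ]
    (j : G →* Γ) (σ : orbitRel.Quotient G X → Γ) : StabilizerCoprod G X →* Γ :=
  CoprodI.lift fun v =>
    ((MulAut.conj (σ v)⁻¹).toMonoidHom.comp j).comp (stabilizer G v.out).subtype

open MulAction in
@[simp]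
theorem StabilizerCoprod.lift_of {G X Γ : Type*} [Group G] [MulAction G X] [Group Γ] (j : G →* Γ)
    (σ : orbitRel.Quotient G X → Γ) (v : orbitRel.Quotient G X) (a : stabilizer G v.out) :
    StabilizerCoprod.lift j σ (StabilizerCoprod.of v a) = (σ v)⁻¹ * j a * σ v := by
  simp [StabilizerCoprod.lift, StabilizerCoprod.of]

/-- A subgroup containing all the stabilizers contains their free product. -/
theorem StabilizerCoprod.mem_of_forall {G X P : Type*} [Group G] [MulAction G X] [Group P]
    (S : Subgroup P) (f : StabilizerCoprod G X →* P)
    (h : ∀ v a, f (StabilizerCoprod.of v a) ∈ S) (p : StabilizerCoprod G X) : f p ∈ S := by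
  induction p using CoprodI.induction_on with
  | one => rw [map_one]; exact one_mem _
  | of v a => exact h v a
  | mul x y hx hy => rw [map_mul]; exact mul_mem hx hy

/-- A subgroup containing the images of the free generators contains the image of the free
group. -/
theorem freeGroup_map_mem_of_forall {E P : Type*} [Group P] (S : Subgroup P) (f : FreeGroup E →* P)
    (h : ∀ i, f (FreeGroup.of i) ∈ S) (p : FreeGroup E) : f p ∈ S := by
  induction p using FreeGroup.induction_on with
  | C1 => rw [map_one]; exact one_mem _
  | of i => exact h i
  | inv_of i hi => rw [map_inv]; exact inv_mem hi
  | mul x y hx hy => rw [map_mul]; exact mul_mem hx hy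

open MulAction in
/-- The free product isomorphic to the point stabilizers of an action of an HNN extension. -/
abbrev HNNExtension.StabilizerModel {G : Type*} (X : Type*) [Group G] (A : Subgroup G)
    [MulAction G X] : Type _ :=
  Coprod (StabilizerCoprod G X) (FreeGroup (orbitRel.Quotient A X))

open MulAction in
/-- A point stabilizer of an action of an HNN extension for which the base group is transitive and
the associated subgroup is free. -/
theorem HNNExtension.nonempty_stabilizer_equiv {G X : Type*} [Group G] {A B : Subgroup G}
    {φ : A ≃* B} [MulAction G X] [MulAction (HNNExtension G A B φ) X]
    (hof : ∀ (g : G) (x : X), (of g : HNNExtension G A B φ) • x = g • x)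
    [IsPretransitive G X] (hfree : IsFreeAction A X) (v₀ : orbitRel.Quotient G X) :
    Nonempty (StabilizerModel X A ≃* stabilizer (HNNExtension G A B φ) v₀.out) := by
  let T : HNNExtension G A B φ := t
  let f : ∀ v : orbitRel.Quotient G X, stabilizer G v.out →* StabilizerModel X A := fun v =>
    Coprod.inl.comp (StabilizerCoprod.of v)
  have hd : IsCocycle (orbitCocycle f) := isCocycle_orbitCocycle f
  have hTmul : ∀ a : A, T * of (a : G) = of (φ a : G) * T := t_mul_of
  have hT : ∀ (a : A) (x : X), T • a • x = (φ a : G) • T • x := by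
    intro a x
    rw [Subgroup.smul_def, ← hof, ← hof, ← mul_smul, ← mul_smul, hTmul]
  -- The stable letter must translate fibres by a function intertwining the cocycles of a and φ a.
  -- Freeness leaves its values at the `A`-orbit representatives arbitrary, and they are taken to be
  -- the free generators.
  obtain ⟨e, he, heε, hrep⟩ := hfree.exists_transfer
    (d₁ := fun a x => orbitCocycle f (a : G) x)
    (d₂ := fun a x => orbitCocycle f (φ a : G) (T • x))
    (fun a b x => hd a b x)
    (fun a b x => by
      dsimp only
      rw [hT, map_mul, Subgroup.coe_mul, hd])
    (fun ω => Coprod.inr (FreeGroup.of ω))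
  have hrel : ∀ a : A, skewPerm (MulAction.toPerm T) e * skewHom hd (a : G) =
      skewHom hd (φ a : G) * skewPerm (MulAction.toPerm T) e := by
    intro a
    refine Equiv.ext ?_
    rintro ⟨x, p⟩
    simp only [Equiv.Perm.mul_apply, skewHom_apply, skewPerm_apply, MulAction.toPerm_apply,
      ← mul_assoc]
    rw [← hT, ← he]
    rfl
  let F : HNNExtension G A B φ →* Equiv.Perm (X × StabilizerModel X A) :=
    lift (skewHom hd) (skewPerm (MulAction.toPerm T) e) hrel
  have hFof : ∀ g x p, F (of g) (x, p) = (g • x, orbitCocycle f g x * p) := by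
    intro g x p
    simp only [F, lift_of, skewHom_apply]
  have hFT : ∀ x p, F T (x, p) = (T • x, e x * p) := by
    intro x p
    simp only [F, T, lift_t, skewPerm_apply, MulAction.toPerm_apply]
  let τ : X → HNNExtension G A B φ := fun x => of (orbitSection G x)
  -- The generator of ω goes to the loop along its edge: out to the representative by τ, across by
  -- the stable letter, and back by τ⁻¹.
  let Ψ : StabilizerModel X A →* HNNExtension G A B φ := Coprod.lift
    (StabilizerCoprod.lift of fun _ => 1)
    (FreeGroup.lift fun ω => (τ (T • ω.out))⁻¹ * T * τ ω.out)
  have hΨd : ∀ g x, Ψ (orbitCocycle f g x) = (τ (g • x))⁻¹ * of g * τ x := by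
    intro g x
    have := map_orbitCocycle f Ψ of (fun _ => 1) (fun v a => by simp [f, Ψ]) g x
    simpa [τ] using this
  have hΨe : ∀ x, Ψ (e x) = (τ (T • x))⁻¹ * T * τ x := by
    intro x
    obtain ⟨a, ω, rfl⟩ := hrep x
    have h1 : Ψ (e ω.out) = (τ (T • ω.out))⁻¹ * T * τ ω.out := by
      rw [heε]
      simp [Ψ]
    rw [eq_mul_inv_of_mul_eq (he a ω.out), map_mul, map_mul, map_inv, hΨd, hΨd, h1, hT,
      Subgroup.smul_def]
    have h2 : of (φ a : G) * T * (of (a : G))⁻¹ = T := by rw [← hTmul]; group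
    have h3 : ∀ y z, y⁻¹ * T * z = y⁻¹ * (of (φ a : G) * T * (of (a : G))⁻¹) * z := by simp [h2]
    rw [h3 (τ ((φ a : G) • T • ω.out))]
    group
  refine SkewLift.nonempty_stabilizer_equiv (F := F) (Ψ := Ψ) (τ := τ) (fun g => ?_) ?_
  · induction g using HNNExtension.induction_on with
    | of g =>
      exact ⟨orbitCocycle f g, fun x p => by rw [hFof, hof], fun x => by rw [hΨd, hof]⟩
    | t => exact ⟨e, hFT, hΨe⟩
    | mul x y hx hy => exact hx.mul hy
    | inv x hx => exact hx.inv
  · have : Subsingleton (orbitRel.Quotient G X) :=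
      (pretransitive_iff_subsingleton_quotient G X).1 inferInstance
    have hv : ∀ v : orbitRel.Quotient G X, v = v₀ := fun v => Subsingleton.elim _ _
    -- The element τ x carries the base fibre to the fibre over x without changing the
    -- `P`-coordinate, so a loop acts on the base fibre by the translation met along its edge.
    have hFτ : ∀ x q, F (τ x) (v₀.out, q) = (x, q) := by
      intro x q
      rw [hFof, ← hv (Quotient.mk'' x), orbitSection_smul, orbitCocycle_section, one_mul]
    have hFτ' : ∀ x q, F (τ x)⁻¹ (x, q) = (v₀.out, q) := fun x q => by
      rw [map_inv, Equiv.Perm.inv_eq_iff_eq, hFτ]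
    intro p
    change p ∈ translationSubgroup F Ψ v₀.out
    induction p using Coprod.induction_on with
    | inl p =>
      refine StabilizerCoprod.mem_of_forall (translationSubgroup F Ψ v₀.out) Coprod.inl
        (fun v a q => ?_) p
      obtain rfl := hv v
      have h1 : Ψ (Coprod.inl (StabilizerCoprod.of v a)) = of (a : G) := by simp [Ψ]
      rw [h1, hFof, orbitCocycle_stabilizer, mem_stabilizer_iff.1 a.2]
      rfl
    | inr p =>
      refine freeGroup_map_mem_of_forall (translationSubgroup F Ψ v₀.out) Coprod.inr
        (fun ω q => ?_) p
      rw [← heε, hΨe, map_mul, map_mul, Equiv.Perm.mul_apply, Equiv.Perm.mul_apply, hFτ, hFT,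
        hFτ']
    | mul x y hx hy => exact mul_mem hx hy

open MulAction in
/-- The free product isomorphic to the point stabilizers of an action of an amalgamated product. -/
abbrev PushoutI.StabilizerModel (G₀ G₁ X E : Type*) [Group G₀] [Group G₁] [MulAction G₀ X]
    [MulAction G₁ X] : Type _ :=
  Coprod (Coprod (StabilizerCoprod G₀ X) (StabilizerCoprod G₁ X)) (FreeGroup E)

/-- Twisting a cocycle by a coboundary. -/
theorem IsCocycle.twist {G X P : Type*} [Group G] [MulAction G X] [Group P] {d : G → X → P}
    (hd : IsCocycle d) (e : X → P) : IsCocycle fun g x => (e (g • x))⁻¹ * d g x * e x := by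
  intro g h x
  simp only [hd g h, mul_smul]
  group

open MulAction in
/-- A point stabilizer of a transitive action of an amalgamated product on a finite set for which
the amalgamated subgroup is free. -/
theorem PushoutI.nonempty_stabilizer_equiv {G : Fin 2 → Type*} {H X : Type*} [∀ i, Group (G i)]
    [Group H] {φ : ∀ i, H →* G i} [∀ i, MulAction (G i) X] [MulAction H X]
    [MulAction (PushoutI φ) X] [Finite X]
    (hof : ∀ i (g : G i) (x : X), (PushoutI.of i g : PushoutI φ) • x = g • x)
    (hφ : ∀ i (h : H) (x : X), φ i h • x = h • x)
    [IsPretransitive (PushoutI φ) X] (hfree : IsFreeAction H X)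
    (v₀ : orbitRel.Quotient (G 0) X) :
    ∃ T : Finset (orbitRel.Quotient H X),
      T.card + 1 = Nat.card (orbitRel.Quotient (G 0) X) + Nat.card (orbitRel.Quotient (G 1) X) ∧
      Nonempty (PushoutI.StabilizerModel (G 0) (G 1) X {ω : orbitRel.Quotient H X // ω ∉ T} ≃*
        stabilizer (PushoutI φ) v₀.out) := by
  classical
  let o : ∀ i, G i →* PushoutI φ := PushoutI.of
  have hφo : ∀ h, o 1 (φ 1 h) = o 0 (φ 0 h) := fun h =>
    (PushoutI.of_apply_eq_base φ 1 h).trans (PushoutI.of_apply_eq_base φ 0 h).symm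
  have hmk : ∀ i (h : H) (x : X),
      (Quotient.mk'' (h • x) : orbitRel.Quotient (G i) X) = Quotient.mk'' x := fun i h x => by
    rw [← hφ i, mk_smul_eq]
  -- The labels are chosen so that the two paths τ₀ and τ₁, defined below, agree at the
  -- representatives of tree edges.
  obtain ⟨T, σ, hTcard, hσ₀, hσT, hconn⟩ := exists_spanning_tree
    (V := orbitRel.Quotient (G 0) X ⊕ orbitRel.Quotient (G 1) X) (E := orbitRel.Quotient H X)
    (fun ω => Sum.inl (Quotient.mk'' ω.out)) (fun ω => Sum.inr (Quotient.mk'' ω.out))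
    (fun ω => (o 1 (orbitSection (G 1) ω.out))⁻¹ * o 0 (orbitSection (G 0) ω.out))
    (Sum.inl v₀) (by
      intro S h0 hS
      have hS' : ∀ x : X, (Sum.inl (Quotient.mk'' x) ∈ S ↔ Sum.inr (Quotient.mk'' x) ∈ S) := by
        intro x
        have := hS (Quotient.mk'' x)
        rw [← orbitSection_smul (G := H) x, hmk, hmk]
        exact this
      -- A saturated set of vertices is invariant under both factors, hence under the amalgam, so
      -- transitivity gives connectedness.
      have hinv : ∀ (g : PushoutI φ) (x : X), Sum.inl (Quotient.mk'' x) ∈ S →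
          Sum.inl (Quotient.mk'' (g • x)) ∈ S := by
        intro g
        induction g using PushoutI.induction_on with
        | of i g =>
          intro x hx
          rw [hof]
          fin_cases i
          · change Sum.inl (Quotient.mk'' ((show G 0 from g) • x)) ∈ S
            rwa [mk_smul_eq]
          · change Sum.inl (Quotient.mk'' ((show G 1 from g) • x)) ∈ S
            rw [hS', mk_smul_eq, ← hS']
            exact hx
        | base h =>
          intro x hx
          rw [← PushoutI.of_apply_eq_base φ 0, hof, mk_smul_eq]
          exact hx
        | mul g k hg hk =>
          intro x hx
          rw [mul_smul]
          exact hg _ (hk _ hx)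
      have hall : ∀ x : X, Sum.inl (Quotient.mk'' x) ∈ S := by
        intro x
        obtain ⟨g, rfl⟩ := exists_smul_eq (PushoutI φ) v₀.out x
        refine hinv g _ ?_
        rwa [show (Quotient.mk'' v₀.out : orbitRel.Quotient (G 0) X) = v₀ from
          Quotient.out_eq' v₀]
      refine Set.eq_univ_of_forall ?_
      rintro (v | v)
      · induction v using Quotient.inductionOn'
        exact hall _
      · induction v using Quotient.inductionOn'
        exact (hS' _).1 (hall _))
  refine ⟨T, by rw [hTcard, Nat.card_sum], ?_⟩
  let P := PushoutI.StabilizerModel (G 0) (G 1) X {ω : orbitRel.Quotient H X // ω ∉ T}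
  let _ : Group P := inferInstance
  let f₀ : ∀ v : orbitRel.Quotient (G 0) X, stabilizer (G 0) v.out →* P := fun v =>
    (Coprod.inl.comp Coprod.inl).comp (StabilizerCoprod.of v)
  let f₁ : ∀ v : orbitRel.Quotient (G 1) X, stabilizer (G 1) v.out →* P := fun v =>
    (Coprod.inl.comp Coprod.inr).comp (StabilizerCoprod.of v)
  have hd₀ := isCocycle_orbitCocycle (P := P) (G := G 0) f₀
  have hd₁ := isCocycle_orbitCocycle (P := P) (G := G 1) f₁
  -- Edges of the tree receive the value 1; each remaining edge receives its own free generator.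
  obtain ⟨e, he, heε, hrep⟩ := hfree.exists_transfer (P := P)
    (d₁ := fun h x => orbitCocycle (P := P) (G := G 0) f₀ (φ 0 h) x)
    (d₂ := fun h x => orbitCocycle (P := P) (G := G 1) f₁ (φ 1 h) x)
    (fun a b x => by
      dsimp only
      rw [map_mul, hd₀, hφ])
    (fun a b x => by
      dsimp only
      rw [map_mul, hd₁, hφ])
    (fun ω => if h : ω ∈ T then 1 else Coprod.inr (FreeGroup.of ⟨ω, h⟩))
  -- Twisting the cocycle of the second factor by e makes the two actions agree on `H`, so they
  -- glue.
  let F₀ : ∀ i, G i →* Equiv.Perm (X × P) := fun i => match i with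
    | 0 => skewHom hd₀
    | 1 => skewHom (hd₁.twist e)
  have hrel : ∀ i, (F₀ i).comp (φ i) = (F₀ 0).comp (φ 0) := by
    refine Fin.forall_fin_two.2 ⟨rfl, ?_⟩
    ext1 h
    refine Equiv.ext ?_
    rintro ⟨x, p⟩
    change (φ 1 h • x,
        (e (φ 1 h • x))⁻¹ * orbitCocycle (P := P) (G := G 1) f₁ (φ 1 h) x * e x * p) =
      (φ 0 h • x, orbitCocycle (P := P) (G := G 0) f₀ (φ 0 h) x * p)
    rw [hφ, hφ, mul_assoc (e (h • x))⁻¹, ← he, inv_mul_cancel_left]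
  let F : PushoutI φ →* Equiv.Perm (X × P) := PushoutI.lift F₀ _ hrel
  have hF₀ : ∀ g x p, F (o 0 g) (x, p) = (g • x, orbitCocycle (P := P) (G := G 0) f₀ g x * p) := by
    intro g x p
    have : F (o 0 g) = F₀ 0 g := PushoutI.lift_of _ _ _ _
    rw [this]
    rfl
  have hF₁ : ∀ g x p, F (o 1 g) (x, p) =
      (g • x, (e (g • x))⁻¹ * orbitCocycle (P := P) (G := G 1) f₁ g x * e x * p) := by
    intro g x p
    have : F (o 1 g) = F₀ 1 g := PushoutI.lift_of _ _ _ _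
    rw [this]
    rfl
  let τ₀ : X → PushoutI φ := fun x => o 0 (orbitSection (G 0) x) * σ (Sum.inl (Quotient.mk'' x))
  let τ₁ : X → PushoutI φ := fun x => o 1 (orbitSection (G 1) x) * σ (Sum.inr (Quotient.mk'' x))
  have hτ : ∀ ω ∈ T, τ₁ ω.out = τ₀ ω.out := by
    intro ω hω
    simp only [τ₀, τ₁, hσT ω hω]
    group
  let Ψ : P →* PushoutI φ := Coprod.lift
    (Coprod.lift (StabilizerCoprod.lift (o 0) fun v => σ (Sum.inl v))
      (StabilizerCoprod.lift (o 1) fun v => σ (Sum.inr v)))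
    (FreeGroup.lift fun ω => (τ₁ ω.1.out)⁻¹ * τ₀ ω.1.out)
  have hΨf₀ : ∀ v a, Ψ (f₀ v a) = (σ (Sum.inl v))⁻¹ * o 0 a * σ (Sum.inl v) :=
    fun v a => StabilizerCoprod.lift_of (G := G 0) (o 0) (fun v => σ (Sum.inl v)) v a
  have hΨf₁ : ∀ v a, Ψ (f₁ v a) = (σ (Sum.inr v))⁻¹ * o 1 a * σ (Sum.inr v) :=
    fun v a => StabilizerCoprod.lift_of (G := G 1) (o 1) (fun v => σ (Sum.inr v)) v a
  have hΨd₀ : ∀ g x, Ψ (orbitCocycle (P := P) (G := G 0) f₀ g x) = (τ₀ (g • x))⁻¹ * o 0 g * τ₀ x :=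
    map_orbitCocycle (P := P) (G := G 0) f₀ Ψ (o 0) (fun v => σ (Sum.inl v)) hΨf₀
  have hΨd₁ : ∀ g x, Ψ (orbitCocycle (P := P) (G := G 1) f₁ g x) = (τ₁ (g • x))⁻¹ * o 1 g * τ₁ x :=
    map_orbitCocycle (P := P) (G := G 1) f₁ Ψ (o 1) (fun v => σ (Sum.inr v)) hΨf₁
  have hΨeω : ∀ ω : orbitRel.Quotient H X, Ψ (e ω.out) = (τ₁ ω.out)⁻¹ * τ₀ ω.out := by
    intro ω
    rw [heε]
    split_ifs with hω
    · rw [hτ ω hω, map_one, inv_mul_cancel]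
    · exact FreeGroup.lift_apply_of
  have hΨe : ∀ x, Ψ (e x) = (τ₁ x)⁻¹ * τ₀ x := by
    intro x
    obtain ⟨h, ω, rfl⟩ := hrep x
    rw [eq_mul_inv_of_mul_eq (he h ω.out), map_mul, map_mul, map_inv, hΨd₀, hΨd₁, hΨeω, hφ, hφ,
      hφo]
    group
  refine SkewLift.nonempty_stabilizer_equiv (F := F) (Ψ := Ψ) (τ := τ₀) (fun g => ?_) ?_
  · have hlift₀ : ∀ g : G 0, SkewLift F Ψ τ₀ (o 0 g) := fun g =>
      ⟨orbitCocycle (P := P) (G := G 0) f₀ g, fun x p => by rw [hF₀, hof],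
        fun x => by rw [hΨd₀, hof]⟩
    induction g using PushoutI.induction_on with
    | of i g =>
      revert g
      revert i
      refine Fin.forall_fin_two.2 ⟨hlift₀, fun g => ?_⟩
      refine ⟨fun x => (e (g • x))⁻¹ * orbitCocycle (P := P) (G := G 1) f₁ g x * e x,
        fun x p => ?_, fun x => ?_⟩
      · exact (hF₁ g x p).trans (by rw [hof])
      · rw [map_mul, map_mul, map_inv, hΨe, hΨe, hΨd₁, hof]
        simp only [o]
        group
    | base h =>
      rw [← PushoutI.of_apply_eq_base φ 0]
      exact hlift₀ _
    | mul x y hx hy => exact hx.mul hy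
  · have hs₀ : ∀ x q, F (o 0 (orbitSection (G 0) x))
        ((Quotient.mk'' x : orbitRel.Quotient (G 0) X).out, q) = (x, q) := fun x q => by
      rw [hF₀, orbitSection_smul, orbitCocycle_section, one_mul]
    have hs₁ : ∀ x q, F (o 1 (orbitSection (G 1) x))
        ((Quotient.mk'' x : orbitRel.Quotient (G 1) X).out,
          (e (Quotient.mk'' x : orbitRel.Quotient (G 1) X).out)⁻¹ * q) = (x, (e x)⁻¹ * q) :=
      fun x q => by
        rw [hF₁, orbitSection_smul, orbitCocycle_section, mul_one, mul_assoc, mul_inv_cancel_left]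
    -- These are the vertices whose potential moves the base fibre correctly, the second factor
    -- being seen through the shift by e⁻¹. Since e = 1 on tree edges, `R` is saturated along the
    -- tree and contains every vertex.
    let R : Set (orbitRel.Quotient (G 0) X ⊕ orbitRel.Quotient (G 1) X) :=
      {w | ∀ q, F (σ w) (v₀.out, q) = Sum.elim (fun v => (v.out, q))
        (fun v => (v.out, (e v.out)⁻¹ * q)) w}
    have hτ₀R : ∀ x, Sum.inl (Quotient.mk'' x) ∈ R ↔ ∀ q, F (τ₀ x) (v₀.out, q) = (x, q) := by
      intro x
      refine forall_congr' fun q => ?_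
      rw [map_mul, Equiv.Perm.mul_apply, ← (F (o 0 (orbitSection (G 0) x))).apply_eq_iff_eq]
      change _ = F (o 0 (orbitSection (G 0) x)) (_, q) ↔ _
      rw [hs₀]
    have hτ₁R : ∀ x, Sum.inr (Quotient.mk'' x) ∈ R ↔
        ∀ q, F (τ₁ x) (v₀.out, q) = (x, (e x)⁻¹ * q) := by
      intro x
      refine forall_congr' fun q => ?_
      rw [map_mul, Equiv.Perm.mul_apply, ← (F (o 1 (orbitSection (G 1) x))).apply_eq_iff_eq]
      change _ = F (o 1 (orbitSection (G 1) x)) (_, _ * q) ↔ _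
      rw [hs₁]
    have hR : ∀ w, w ∈ R := by
      refine Set.eq_univ_iff_forall.1 (hconn R (fun q => ?_) fun ω hω => ?_)
      · rw [hσ₀, map_one]
        rfl
      · rw [hτ₀R, hτ₁R, hτ ω hω, heε, dif_pos hω]
        simp
    have hFτ₀ : ∀ x q, F (τ₀ x) (v₀.out, q) = (x, q) := fun x => (hτ₀R x).1 (hR _)
    have hFτ₁ : ∀ x q, F (τ₁ x) (v₀.out, q) = (x, (e x)⁻¹ * q) := fun x => (hτ₁R x).1 (hR _)
    have hR₀ : ∀ v q, F (σ (Sum.inl v)) (v₀.out, q) = (v.out, q) := fun v => hR (Sum.inl v)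
    have hR₁ : ∀ v q, F (σ (Sum.inr v)) (v₀.out, q) = (v.out, (e v.out)⁻¹ * q) :=
      fun v => hR (Sum.inr v)
    intro p
    change p ∈ translationSubgroup F Ψ v₀.out
    induction p using Coprod.induction_on with
    | inl p =>
      induction p using Coprod.induction_on with
      | inl p =>
        refine StabilizerCoprod.mem_of_forall (translationSubgroup F Ψ v₀.out)
          (Coprod.inl.comp Coprod.inl) (fun v a q => ?_) p
        change F (Ψ (f₀ v a)) (v₀.out, q) = (v₀.out, f₀ v a * q)
        rw [hΨf₀, mul_assoc, map_mul, map_inv, Equiv.Perm.mul_apply, Equiv.Perm.inv_eq_iff_eq,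
          map_mul, Equiv.Perm.mul_apply, hR₀, hR₀, hF₀, orbitCocycle_stabilizer,
          mem_stabilizer_iff.1 a.2]
      | inr p =>
        refine StabilizerCoprod.mem_of_forall (translationSubgroup F Ψ v₀.out)
          (Coprod.inl.comp Coprod.inr) (fun v a q => ?_) p
        change F (Ψ (f₁ v a)) (v₀.out, q) = (v₀.out, f₁ v a * q)
        rw [hΨf₁, mul_assoc, map_mul, map_inv, Equiv.Perm.mul_apply, Equiv.Perm.inv_eq_iff_eq,
          map_mul, Equiv.Perm.mul_apply, hR₁, hR₁, hF₁, orbitCocycle_stabilizer,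
          mem_stabilizer_iff.1 a.2]
        simp [mul_assoc]
      | mul x y hx hy => rw [map_mul]; exact mul_mem hx hy
    | inr p =>
      refine freeGroup_map_mem_of_forall (translationSubgroup F Ψ v₀.out) Coprod.inr
        (fun ω q => ?_) p
      have h1 : (Coprod.inr (FreeGroup.of ω) : P) = e ω.1.out := by rw [heε, dif_neg ω.2]
      rw [h1, hΨe, map_mul, map_inv, Equiv.Perm.mul_apply, Equiv.Perm.inv_eq_iff_eq, hFτ₀, hFτ₁,
        inv_mul_cancel_left]
    | mul x y hx hy => exact mul_mem hx hy

/-! ### Finite actions and the final count -/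

/-- In a residually finite or virtually torsion free group, finitely many elements of finite order
can be separated from the identity by a normal subgroup of finite index. -/
theorem exists_normal_finiteIndex_inter {G : Type*} [Group G]
    (hG : Group.ResiduallyFinite G ∨ VirtuallyTorsionFree G) {S : Set G} (hS : S.Finite)
    (hfin : ∀ s ∈ S, IsOfFinOrder s) :
    ∃ N : Subgroup G, N.Normal ∧ N.FiniteIndex ∧ ∀ s ∈ S, s ∈ N → s = 1 := by
  rcases hG with hG | ⟨K, hK, hKt⟩
  · have h1 : ∀ s : S, ∃ N : Subgroup G, N.Normal ∧ N.FiniteIndex ∧ (s.1 ∈ N → s.1 = 1) := by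
      intro s
      by_cases hs : s.1 = 1
      · exact ⟨⊤, inferInstance, inferInstance, fun _ => hs⟩
      · obtain ⟨N, hN⟩ := Group.exists_finiteIndexNormalSubgroup_notMem s.1 hs
        exact ⟨N.toSubgroup, inferInstance, inferInstance, fun h => absurd h hN⟩
    choose N hN hNf hNs using h1
    have := hS.to_subtype
    exact ⟨⨅ s, N s, Subgroup.normal_iInf_normal hN, Subgroup.finiteIndex_iInf hNf,
      fun s hs h => hNs ⟨s, hs⟩ (Subgroup.mem_iInf.1 h _)⟩
  · exact ⟨K.normalCore, inferInstance, inferInstance,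
      fun s hs h => hKt s (K.normalCore_le h) (hfin s hs)⟩

theorem smul_quotient_eq_self_iff {G : Type*} [Group G] (N : Subgroup G) [N.Normal] (g : G)
    (q : G ⧸ N) : g • q = q ↔ g ∈ N := by
  induction q using QuotientGroup.induction_on with
  | H a =>
    rw [MulAction.Quotient.smul_mk, smul_eq_mul, eq_comm, QuotientGroup.eq, ← mul_assoc,
      Subgroup.Normal.mem_comm_iff inferInstance, mul_inv_cancel_left]

namespace IsFreelyAdditive

variable {C : (G : Type u) → [Group G] → Prop} {χ : (G : Type u) → [Group G] → ℝ}

/-- By transitivity the stabilizer has index |X|, so it can serve to compute Wall's extension. -/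
theorem wallExtension_of_transitive (h : IsFreelyAdditive C χ) {Γ X P : Type u} [Group Γ]
    [MulAction Γ X] [MulAction.IsPretransitive Γ X] [Finite X] [Group P] {r : ℝ}
    (hP : HasEuler C χ P r) {x : X} (e : P ≃* MulAction.stabilizer Γ x) :
    VirtuallyIn C Γ ∧ wallExtension C χ Γ = r / Nat.card X := by
  have hindex := MulAction.index_stabilizer_of_transitive Γ x
  have : Nonempty X := ⟨x⟩
  have hfin : (MulAction.stabilizer Γ x).FiniteIndex := ⟨by rw [hindex]; exact Nat.card_pos.ne'⟩
  have hK := h.hasEuler_congr e hP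
  refine ⟨⟨_, hfin, hK.1⟩, ?_⟩
  rw [wallExtension_eq h.index h.iso h.euler _ hfin hK.1, hK.2, hindex]

-- Take X = G/N with N normal of finite index meeting H and H' trivially. The two actions of H on X,
-- direct and through φ, are free, hence isomorphic; an isomorphism serves as the stable letter. As
-- G is transitive on X, χ of the stabilizer is |X| χ(G) − |X|/|H|.
open MulAction in
theorem wallExtension_hnnExtension (h : IsFreelyAdditive C χ) {G : Type u} [Group G] (hG : C G)
    (hG' : Group.ResiduallyFinite G ∨ VirtuallyTorsionFree G) {H H' : Subgroup G} [Finite H]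
    (φ : H ≃* H') :
    VirtuallyIn C (HNNExtension G H H' φ) ∧
      wallExtension C χ (HNNExtension G H H' φ) = χ G - 1 / (Nat.card H : ℝ) := by
  have : Finite H' := Finite.of_equiv H φ.toEquiv
  obtain ⟨N, hN, hNf, hNS⟩ := exists_normal_finiteIndex_inter hG'
    (S := (H : Set G) ∪ (H' : Set G)) ((Set.toFinite _).union (Set.toFinite _)) (by
      rintro s (hs | hs)
      · exact H.subtype.isOfFinOrder (isOfFinOrder_of_finite (⟨s, hs⟩ : H))
      · exact H'.subtype.isOfFinOrder (isOfFinOrder_of_finite (⟨s, hs⟩ : H')))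
  have hfree : IsFreeAction H (G ⧸ N) := fun a q ha =>
    Subtype.ext (hNS a (Or.inl a.2) ((smul_quotient_eq_self_iff N (a : G) q).1 ha))
  obtain ⟨θ, hθ⟩ : ∃ θ : Equiv.Perm (G ⧸ N),
      ∀ (a : H) (q : G ⧸ N), θ ((a : G) • q) = (φ a : G) • θ q := by
    refine exists_equivariant_equiv (H := H) (A := G ⧸ N) (B := G ⧸ N) _
      (MulAction.compHom (G ⧸ N) (H'.subtype.comp φ.toMonoidHom)) hfree (fun a q ha => ?_) rfl
    have h1 : (φ a : G) = 1 := hNS (φ a) (Or.inr (φ a).2)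
      ((smul_quotient_eq_self_iff N (φ a : G) q).1 ha)
    exact φ.injective (Subtype.ext (by rw [h1, map_one]; rfl))
  let ρ : HNNExtension G H H' φ →* Equiv.Perm (G ⧸ N) :=
    HNNExtension.lift (MulAction.toPermHom G (G ⧸ N)) θ fun a => Equiv.ext fun q => hθ a q
  let _ : MulAction (HNNExtension G H H' φ) (G ⧸ N) := MulAction.compHom _ ρ
  have hof : ∀ (g : G) (q : G ⧸ N), (HNNExtension.of g : HNNExtension G H H' φ) • q = g • q :=
    fun g q => by
      change ρ (HNNExtension.of g) q = g • q
      rw [HNNExtension.lift_of]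
      rfl
  have : IsPretransitive (HNNExtension G H H' φ) (G ⧸ N) := ⟨fun x y => by
    obtain ⟨g, rfl⟩ := exists_smul_eq G x y
    exact ⟨HNNExtension.of g, hof g x⟩⟩
  obtain ⟨e⟩ := HNNExtension.nonempty_stabilizer_equiv hof hfree
    (Quotient.mk'' ((1 : G) : G ⧸ N) : orbitRel.Quotient G (G ⧸ N))
  have hP := h.hasEuler_coprod_freeGroup (h.hasEuler_coprodI_stabilizer (X := G ⧸ N) hG)
    (orbitRel.Quotient H (G ⧸ N))
  obtain ⟨h1, h2⟩ := h.wallExtension_of_transitive hP e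
  refine ⟨h1, ?_⟩
  have hsub : Subsingleton (orbitRel.Quotient G (G ⧸ N)) :=
    (pretransitive_iff_subsingleton_quotient G (G ⧸ N)).1 inferInstance
  have hone : Nat.card (orbitRel.Quotient G (G ⧸ N)) = 1 :=
    Nat.card_eq_one_iff_unique.2 ⟨hsub, ⟨Quotient.mk'' ((1 : G) : G ⧸ N)⟩⟩
  have hX : (Nat.card (G ⧸ N) : ℝ) ≠ 0 := Nat.cast_ne_zero.2 Nat.card_pos.ne'
  have hH : (Nat.card H : ℝ) ≠ 0 := Nat.cast_ne_zero.2 Nat.card_pos.ne'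
  have hcard : (Nat.card (G ⧸ N) : ℝ) =
      Nat.card (orbitRel.Quotient H (G ⧸ N)) * Nat.card H := by exact_mod_cast hfree.card_eq
  have hinv : 1 / (Nat.card H : ℝ) * Nat.card (G ⧸ N) =
      Nat.card (orbitRel.Quotient H (G ⧸ N)) := by
    rw [hcard]
    field_simp
  rw [h2, div_eq_iff hX, sub_mul, hinv, hone]
  push_cast
  ring

end IsFreelyAdditive

/-- The action on the first factor of a product. -/
def fstPermHom (G X Y : Type*) [Group G] [MulAction G X] : G →* Equiv.Perm (X × Y) :=
  MonoidHom.toHomPerm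
    { toFun := fun g z => (g • z.1, z.2)
      map_one' := funext fun z => Prod.ext (one_smul G z.1) rfl
      map_mul' := fun g h => funext fun z => Prod.ext (mul_smul g h z.1) rfl }

/-- Two finite quotients of the factors in which `H` embeds give an action of the amalgamated
product on a finite set for which `H` is free. -/
theorem PushoutI.exists_finite_action {G : Fin 2 → Type u} [∀ i, Group (G i)] {H : Type*}
    [Group H] [Finite H] {φ : ∀ i, H →* G i} (N : ∀ i, Subgroup (G i)) [∀ i, (N i).Normal]
    [∀ i, (N i).FiniteIndex] (hN : ∀ i h, φ i h ∈ N i → h = 1) :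
    ∃ (Y : Type u) (_ : Finite Y) (_ : Nonempty Y) (ρ : PushoutI φ →* Equiv.Perm Y),
      ∀ h y, ρ (PushoutI.base φ h) y = y → h = 1 := by
  -- The quotients may differ in size. Multiplying each by the other, with trivial action on the
  -- added factor, gives two free `H`-sets of equal cardinality, which θ identifies.
  let Q : Fin 2 → Type u := fun i => G i ⧸ N i
  let F₀ : G 0 →* Equiv.Perm (Q 0 × Q 1) := fstPermHom (G 0) (G 0 ⧸ N 0) (Q 1)
  let F₁ : G 1 →* Equiv.Perm (Q 1 × Q 0) := fstPermHom (G 1) (G 1 ⧸ N 1) (Q 0)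
  let i₀ : MulAction H (Q 0 × Q 1) := MulAction.compHom _ (F₀.comp (φ 0))
  let i₁ : MulAction H (Q 1 × Q 0) := MulAction.compHom _ (F₁.comp (φ 1))
  have hfree₀ : IsFreeAction H (Q 0 × Q 1) := fun h z hz =>
    hN 0 h ((smul_quotient_eq_self_iff (N 0) (φ 0 h) z.1).1 (congrArg Prod.fst hz))
  have hfree₁ : IsFreeAction H (Q 1 × Q 0) := fun h z hz =>
    hN 1 h ((smul_quotient_eq_self_iff (N 1) (φ 1 h) z.1).1 (congrArg Prod.fst hz))
  have hfinite : ∀ i, Finite (Q i) := fun i => inferInstanceAs (Finite (G i ⧸ N i))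
  obtain ⟨θ, hθ⟩ := exists_equivariant_equiv i₀ i₁ hfree₀ hfree₁
    (Nat.card_congr (Equiv.prodComm _ _))
  let F : ∀ i, G i →* Equiv.Perm (Q 0 × Q 1) := fun i => match i with
    | 0 => F₀
    | 1 => θ.symm.permCongrHom.toMonoidHom.comp F₁
  have hrel : ∀ i, (F i).comp (φ i) = F₀.comp (φ 0) := by
    refine Fin.forall_fin_two.2 ⟨rfl, ?_⟩
    ext1 h
    refine Equiv.ext fun z => ?_
    change θ.symm (h • θ z) = h • z
    rw [← hθ, Equiv.symm_apply_apply]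
  refine ⟨Q 0 × Q 1, inferInstance, ⟨((1 : G 0) : G 0 ⧸ N 0), ((1 : G 1) : G 1 ⧸ N 1)⟩,
    PushoutI.lift F _ hrel, fun h y hy => hfree₀ h y ?_⟩
  rw [PushoutI.lift_base] at hy
  exact hy

namespace IsFreelyAdditive

variable {C : (G : Type u) → [Group G] → Prop} {χ : (G : Type u) → [Group G] → ℝ}

-- The finite action need not be transitive, so X is a single orbit. With o₀, o₁ orbits of the
-- factors, the tree has o₀ + o₁ − 1 edges; this cancels the orbit terms and leaves |X|(χ(G₀) +
-- χ(G₁)) − |X|/|H|.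
open MulAction in
theorem wallExtension_pushoutI (h : IsFreelyAdditive C χ) {G : Fin 2 → Type u}
    [∀ i, Group (G i)] (hG : ∀ i, C (G i))
    (hG' : ∀ i, Group.ResiduallyFinite (G i) ∨ VirtuallyTorsionFree (G i))
    {H : Type u} [Group H] [Finite H] (φ : ∀ i, H →* G i)
    (hφ : ∀ i, Function.Injective (φ i)) :
    VirtuallyIn C (PushoutI φ) ∧
      wallExtension C χ (PushoutI φ) = χ (G 0) + χ (G 1) - 1 / (Nat.card H : ℝ) := by
  have hsep := fun i => exists_normal_finiteIndex_inter (hG' i) (S := Set.range (φ i))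
    (Set.finite_range _) (by
      rintro _ ⟨a, rfl⟩
      exact (φ i).isOfFinOrder (isOfFinOrder_of_finite a))
  choose N hN hNf hNS using hsep
  obtain ⟨Y, hY, ⟨y₀⟩, ρ, hρ⟩ := PushoutI.exists_finite_action N (φ := φ) fun i a ha =>
    hφ i (by rw [hNS i _ ⟨a, rfl⟩ ha, map_one])
  let _ : MulAction (PushoutI φ) Y := MulAction.compHom Y ρ
  let X := orbit (PushoutI φ) y₀
  let _ : ∀ i, MulAction (G i) X := fun i => MulAction.compHom X (PushoutI.of i : G i →* PushoutI φ)
  let _ : MulAction H X := MulAction.compHom X (PushoutI.base φ)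
  have : Nonempty X := ⟨⟨y₀, mem_orbit_self y₀⟩⟩
  have hfree : IsFreeAction H X := fun a x ha => hρ a x.1 (congrArg Subtype.val ha)
  obtain ⟨T, hT, ⟨e⟩⟩ := PushoutI.nonempty_stabilizer_equiv (φ := φ) (X := X)
    (fun _ _ _ => rfl)
    (fun i a x => congrArg (· • x) (PushoutI.of_apply_eq_base φ i a)) hfree
    (Quotient.mk'' (Classical.arbitrary X))
  have hP := h.hasEuler_coprod_freeGroup
    (h.hasEuler_coprod (h.hasEuler_coprodI_stabilizer (X := X) (hG 0))
      (h.hasEuler_coprodI_stabilizer (X := X) (hG 1))) {ω : orbitRel.Quotient H X // ω ∉ T}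
  obtain ⟨h1, h2⟩ := h.wallExtension_of_transitive hP e
  refine ⟨h1, ?_⟩
  have hX : (Nat.card X : ℝ) ≠ 0 := Nat.cast_ne_zero.2 Nat.card_pos.ne'
  have hH : (Nat.card H : ℝ) ≠ 0 := Nat.cast_ne_zero.2 Nat.card_pos.ne'
  have hcard : (Nat.card X : ℝ) =
      Nat.card (orbitRel.Quotient H X) * Nat.card H := by exact_mod_cast hfree.card_eq
  have hΩ : (Nat.card {ω : orbitRel.Quotient H X // ω ∉ T} : ℝ) =
      Nat.card (orbitRel.Quotient H X) - T.card := by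
    have := Fintype.ofFinite (orbitRel.Quotient H X)
    classical
    rw [Nat.card_eq_fintype_card, Nat.card_eq_fintype_card, Fintype.card_subtype_compl,
      Nat.cast_sub (Fintype.card_subtype_le _), Fintype.card_coe]
  have hT' : (T.card : ℝ) + 1 =
      Nat.card (orbitRel.Quotient (G 0) X) + Nat.card (orbitRel.Quotient (G 1) X) := by
    exact_mod_cast hT
  have hinv : 1 / (Nat.card H : ℝ) * Nat.card X = Nat.card (orbitRel.Quotient H X) := by
    rw [hcard]
    field_simp
  rw [h2, div_eq_iff hX, sub_mul, hinv, hΩ]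
  linear_combination hT'

end IsFreelyAdditive

theorem theorem3p5
    (C : (G : Type u) → [Group G] → Prop)
    (hC_iso : IsGroupClass C)
    (hC_prod : ClosedUnderFreeProducts C)
    (hC_index : ClosedUnderFiniteIndex C)
    (hC_int : C (ULift.{u} (Multiplicative ℤ)))
    (χ : (G : Type u) → [Group G] → ℝ)
    (hχ : IsEulerCharacteristic C χ)
    (hχ_prod : ∀ (A B : Type u) [Group A] [Group B], C A → C B →
      χ (Monoid.Coprod A B) = χ A + χ B - 1) :
    (∀ (G : Type u) [Group G], C G → (Group.ResiduallyFinite G ∨ VirtuallyTorsionFree G) →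
      ∀ (H H' : Subgroup G) [Finite H] (φ : H ≃* H'),
        VirtuallyIn C (HNNExtension G H H' φ) ∧
        wallExtension C χ (HNNExtension G H H' φ) = χ G - 1 / (Nat.card H : ℝ)) ∧
    (∀ (G : Fin 2 → Type u) [∀ i, Group (G i)], (∀ i, C (G i)) →
      (∀ i, Group.ResiduallyFinite (G i) ∨ VirtuallyTorsionFree (G i)) →
      ∀ (H : Type u) [Group H] [Finite H] (φ : ∀ i, H →* G i),
        (∀ i, Function.Injective (φ i)) →
        VirtuallyIn C (Monoid.PushoutI φ) ∧
        wallExtension C χ (Monoid.PushoutI φ) = χ (G 0) + χ (G 1) - 1 / (Nat.card H : ℝ)) := by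

  have h : IsFreelyAdditive C χ := ⟨hC_iso, hC_prod, hC_index, hC_int, hχ, hχ_prod⟩
  exact ⟨fun G _ hG hG' H H' _ φ => h.wallExtension_hnnExtension hG hG' φ,
    fun G _ hG hG' H _ _ φ hφ => h.wallExtension_pushoutI hG hG' φ hφ⟩
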